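/- There is an absolute constant $C>0$ such that the following holds for all integers $n\ge 2$ and $k\ge 1$. Let $P\subseteq[0,k]^n$ be a lattice polytope, that is, the convex hull of finitely many points of $\mathbb{R}^n$ all of whose vertices (extreme points) lie in $\mathbb{Z}^n$. Let $(U,V)$ be a uniformly random pair of orthonormal vectors of $\mathbb{R}^n$, i.e. the first two columns of a Haar-distributed random matrix in the orthogonal group $O(n)$, and let $\pi(x)=(U^{\intercal}x,V^{\intercal}x)\in\mathbb{R}^2$. Then the number of vertices of the random shadow $\pi(P)$ is an integrable random variable, and $$\mathbb{E}\bigl[\#\{\text{vertices of }\pi(P)\}\bigr]\le C\,n\,k .$$ -/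

import Mathlib

open MeasureTheory Set
open scoped Matrix

noncomputable section

namespace RandomShadow

/-- Euclidean space `ℝⁿ`. -/
abbrev E (n : ℕ) : Type := EuclideanSpace ℝ (Fin n)

/-- The orthogonal group `O(n)`, with the topology induced from the space of matrices. -/
abbrev O (n : ℕ) : Type := Matrix.orthogonalGroup (Fin n) ℝ

theorem isCompact_orthogonalGroup (n : ℕ) :
    IsCompact (Matrix.orthogonalGroup (Fin n) ℝ : Set (Matrix (Fin n) (Fin n) ℝ)) := by
  have hbox : IsCompact (Set.pi univ fun _ : Fin n => Set.pi univ fun _ : Fin n =>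
      Icc (-1 : ℝ) 1) :=
    isCompact_univ_pi fun _ => isCompact_univ_pi fun _ => isCompact_Icc
  refine hbox.of_isClosed_subset ?_ ?_
  · have : (Matrix.orthogonalGroup (Fin n) ℝ : Set (Matrix (Fin n) (Fin n) ℝ)) =
        {A | A * star A = 1} := by
      ext A
      exact Matrix.mem_orthogonalGroup_iff (Fin n) ℝ
    rw [this]
    exact isClosed_eq (by fun_prop) continuous_const
  · intro A hA i _ j _
    have h := entry_norm_bound_of_unitary (𝕜 := ℝ) hA i j
    rw [Real.norm_eq_abs, abs_le] at h
    exact h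

instance (n : ℕ) : CompactSpace (O n) :=
  isCompact_iff_compactSpace.mp (isCompact_orthogonalGroup n)

instance (n : ℕ) : MeasurableSpace (O n) := borel (O n)

instance (n : ℕ) : BorelSpace (O n) := ⟨rfl⟩

/-- The Haar measure on the compact group `O(n)` of total mass one. -/
def haarO (n : ℕ) : Measure (O n) := Measure.haarMeasure ⊤

instance (n : ℕ) : IsProbabilityMeasure (haarO n) :=
  ⟨by simpa [haarO] using Measure.haarMeasure_self (K₀ := (⊤ : TopologicalSpace.PositiveCompacts (O n)))⟩

/-- The `j`-th column of an orthogonal matrix, as a vector of `ℝⁿ`. -/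
def column {n : ℕ} (g : O n) (j : Fin n) : E n :=
  WithLp.toLp 2 fun i => (g : Matrix (Fin n) (Fin n) ℝ) i j

/-- The law of a uniformly random pair `(U, V)` of orthonormal vectors of `ℝⁿ`, where `n ≥ 2`:
the law of the first two columns of a Haar distributed orthogonal matrix, that is, the
rotation invariant probability measure on the orthonormal `2`-frames of `ℝⁿ`. -/
def uniformFrame (n : ℕ) (hn : 2 ≤ n) : Measure (E n × E n) :=
  (haarO n).map fun g => (column g ⟨0, by omega⟩, column g ⟨1, by omega⟩)

/-- The projection `x ↦ (Uᵀ x, Vᵀ x)` of `ℝⁿ` to the plane. -/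
def proj {n : ℕ} (U V : E n) (x : E n) : E 2 := !₂[inner ℝ U x, inner ℝ V x]

/-- The shadow of `P` under the projection given by `U` and `V`. -/
def shadow {n : ℕ} (P : Set (E n)) (U V : E n) : Set (E 2) := proj U V '' P

/-- The vertices of a convex set `P`, namely its extreme points. -/
def vertices {n : ℕ} (P : Set (E n)) : Set (E n) := P.extremePoints ℝ

/-- A polytope is the convex hull of a finite set of points. -/
def IsPolytope {n : ℕ} (P : Set (E n)) : Prop :=
  ∃ S : Set (E n), S.Finite ∧ P = convexHull ℝ S

/-- A lattice polytope is a polytope all of whose vertices have integer coordinates. -/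
def IsLatticePolytope {n : ℕ} (P : Set (E n)) : Prop :=
  IsPolytope P ∧ ∀ v ∈ vertices P, ∀ i, ∃ z : ℤ, v i = z

/-- The number of vertices of the shadow of `P` given by the pair `(U, V)`. -/
def shadowSize {n : ℕ} (P : Set (E n)) (UV : E n × E n) : ℝ :=
  ((vertices (shadow P UV.1 UV.2)).ncard : ℝ)

/-- The expected number of vertices of a uniformly random shadow of `P`. -/
def expectedShadowSize {n : ℕ} (hn : 2 ≤ n) (P : Set (E n)) : ℝ :=
  ∫ UV, shadowSize P UV ∂(uniformFrame n hn)

end RandomShadow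

end

namespace RandomShadow

noncomputable section

/-! Almost surely the projected vertices are in general position, and up to an additive constant the
vertices of the shadow are counted by the edges of its upper and lower hulls. So it suffices to
bound the sum, over ordered pairs of vertices `p`, `q` of `P`, of the probability that `q` and `p`
are the left and right ends of an upper (or lower) edge.

Fix `e = p - q`. Whether the pair gives an edge depends only on the sign of `⟨U, e⟩` and on the
direction of `w = ⟨U, e⟩ V - ⟨V, e⟩ U`, the normal to `e` inside the random plane. The stabiliser of
`e` in `O(n)` preserves `⟨U, e⟩` and Haar measure, rotates `w`, and is transitive on directions
orthogonal to `e`. Hence the direction of `w` is independent of `⟨U, e⟩`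
(`lintegral_mul_equivariant_eq_mul`), and the probability of the edge times the mean of `⟨U, e⟩⁺` is
at most the mean of the horizontal length of the edge on that event (`measure_edgeEvent_mul_le`).

Rotation invariance gives the mean of `⟨U, e⟩⁺` as `κ ‖e‖`, and `‖e‖ ≥ 1` for distinct lattice
points. The horizontal lengths of upper edges add up to at most the width of the shadow
(`sum_upperEdges_le`), which is at most `k ‖U‖₁` in the cube, with mean `2nkκ`. The unknown `κ`
cancels: each hull has at most `2nk` expected edges. -/

instance (n : ℕ) : SecondCountableTopology (O n) :=
  inferInstanceAs (SecondCountableTopology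
    {A : Fin n → Fin n → ℝ // A ∈ (Matrix.orthogonalGroup (Fin n) ℝ : Set (Matrix (Fin n) (Fin n) ℝ))})

instance (n : ℕ) : (haarO n).IsMulLeftInvariant := by
  unfold haarO; infer_instance

/-! ### The action of the orthogonal group, frames and stabilisers. -/

/-- The action of an orthogonal matrix on `ℝⁿ`. -/
def rot {n : ℕ} (g : O n) (x : E n) : E n :=
  WithLp.toLp 2 ((g : Matrix (Fin n) (Fin n) ℝ) *ᵥ x.ofLp)

variable {n : ℕ}

theorem rot_mul (g h : O n) (x : E n) : rot (g * h) x = rot g (rot h x) := by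
  simp [rot, Matrix.mulVec_mulVec]

@[simp] theorem rot_one (x : E n) : rot 1 x = x := by
  simp [rot]

theorem rot_smul (g : O n) (a : ℝ) (x : E n) : rot g (a • x) = a • rot g x := by
  simp [rot, Matrix.mulVec_smul]

theorem rot_sub (g : O n) (x y : E n) : rot g (x - y) = rot g x - rot g y := by
  simp [rot, Matrix.mulVec_sub]

theorem rot_inv_rot (g : O n) (x : E n) : rot g⁻¹ (rot g x) = x := by
  rw [← rot_mul]; simp

theorem rot_rot_inv (g : O n) (x : E n) : rot g (rot g⁻¹ x) = x := by
  rw [← rot_mul]; simp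

theorem inner_rot_rot (g : O n) (x y : E n) :
    inner ℝ (rot g x) (rot g y) = inner ℝ x y := by
  have hg : (g : Matrix (Fin n) (Fin n) ℝ)ᵀ * (g : Matrix (Fin n) (Fin n) ℝ) = 1 :=
    (Matrix.mem_orthogonalGroup_iff' (Fin n) ℝ).1 g.2
  simp only [rot, EuclideanSpace.inner_eq_star_dotProduct, star_trivial]
  rw [Matrix.dotProduct_mulVec, Matrix.vecMul_mulVec, hg, Matrix.vecMul_one]

theorem inner_rot_left (g : O n) (x y : E n) :
    inner ℝ (rot g x) y = inner ℝ x (rot g⁻¹ y) := by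
  rw [← inner_rot_rot g x, rot_rot_inv]

theorem continuous_rot : Continuous fun z : O n × E n => rot z.1 z.2 := by
  unfold rot
  apply (PiLp.continuous_toLp 2 _).comp
  exact (continuous_subtype_val.comp continuous_fst).matrix_mulVec
    ((PiLp.continuous_ofLp 2 _).comp continuous_snd)

theorem column_mul (h g : O n) (j : Fin n) : column (h * g) j = rot h (column g j) := by
  ext i
  simp [column, rot, Matrix.mul_apply, Matrix.mulVec, dotProduct]

theorem continuous_column (j : Fin n) : Continuous fun g : O n => column g j := by
  unfold column
  apply (PiLp.continuous_toLp 2 _).comp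
  exact continuous_pi fun i => (continuous_subtype_val.matrix_elem i j)

theorem inner_column (g : O n) (i j : Fin n) :
    inner ℝ (column g i) (column g j) = if i = j then 1 else 0 := by
  have hg : (g : Matrix (Fin n) (Fin n) ℝ)ᵀ * (g : Matrix (Fin n) (Fin n) ℝ) = 1 :=
    (Matrix.mem_orthogonalGroup_iff' (Fin n) ℝ).1 g.2
  have := congrFun (congrFun hg i) j
  rw [Matrix.one_apply] at this
  rw [← this, Matrix.mul_apply]
  simp [column, PiLp.inner_apply, mul_comm]

/-- Vectors of equal length are exchanged by a reflection, which fixes the vectors orthogonal to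
their difference. -/
theorem exists_rot_eq (v w : E n) (h : ‖v‖ = ‖w‖) :
    ∃ g : O n, rot g v = w ∧ ∀ e : E n, inner ℝ e (v - w) = 0 → rot g e = e := by
  set R := (Submodule.span ℝ {v - w})ᗮ.reflection with hR
  let b := EuclideanSpace.basisFun (Fin n) ℝ
  have hmem : LinearMap.toMatrix b.toBasis b.toBasis R.toLinearEquiv.toLinearMap ∈
      Matrix.orthogonalGroup (Fin n) ℝ := by
    have := (b.toMatrix_orthonormalBasis_mem_unitary (b.map R))
    convert this using 1
    ext i j
    simp [LinearMap.toMatrix_apply, Module.Basis.toMatrix_apply]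
  refine ⟨⟨_, hmem⟩, ?_⟩
  have key : ∀ x, rot ⟨_, hmem⟩ x = R x := by
    intro x
    have := LinearMap.toMatrix_mulVec_repr b.toBasis b.toBasis R.toLinearEquiv.toLinearMap x
    ext i
    exact congrFun this i
  refine ⟨by rw [key]; exact Submodule.reflection_sub h, fun e he => ?_⟩
  rw [key]
  apply Submodule.reflection_mem_subspace_eq_self
  rw [Submodule.mem_orthogonal_singleton_iff_inner_right, real_inner_comm]
  exact he

/-- The subgroup of `O(n)` fixing a vector. -/
def stab (e : E n) : Subgroup (O n) where
  carrier := {g | rot g e = e}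
  mul_mem' {a b} ha hb := by
    change rot (a * b) e = e
    rw [rot_mul, show rot b e = e from hb]; exact ha
  one_mem' := rot_one e
  inv_mem' {a} ha := by
    change rot a⁻¹ e = e
    conv_lhs => rw [← show rot a e = e from ha]
    exact rot_inv_rot a e

theorem mem_stab {e : E n} {g : O n} : g ∈ stab e ↔ rot g e = e := Iff.rfl

instance (e : E n) : CompactSpace (stab e) := by
  apply isCompact_iff_compactSpace.mp
  apply IsClosed.isCompact
  exact isClosed_eq (continuous_rot.comp (continuous_id.prodMk continuous_const)) continuous_const

instance (e : E n) : BorelSpace (stab e) := Subtype.borelSpace _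

/-- The normalised Haar measure on the stabiliser of a vector. -/
def haarStab (e : E n) : Measure (stab e) := Measure.haarMeasure ⊤

instance (e : E n) : IsProbabilityMeasure (haarStab e) :=
  ⟨by simpa [haarStab] using
    Measure.haarMeasure_self (K₀ := (⊤ : TopologicalSpace.PositiveCompacts (stab e)))⟩

instance (e : E n) : (haarStab e).IsMulLeftInvariant := by
  unfold haarStab; infer_instance

/-! ### Averaging over a stabiliser: independence of weight and direction. -/

/-- The average of a function over the orbit of a vector under the stabiliser of `e`. -/
def orbitAverage (e : E n) (f : E n → ENNReal) (w : E n) : ENNReal :=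
  ∫⁻ h, f (rot (h : O n)⁻¹ w) ∂(haarStab e)

theorem orbitAverage_rot (e : E n) (f : E n → ENNReal) (w : E n) (k : stab e) :
    orbitAverage e f (rot (k : O n) w) = orbitAverage e f w := by
  unfold orbitAverage
  rw [← lintegral_mul_left_eq_self (μ := haarStab e) (fun h => f (rot (h : O n)⁻¹ w)) k⁻¹]
  congr 1 with h
  rw [← rot_mul]
  simp

theorem orbitAverage_smul (e : E n) (f : E n → ENNReal)
    (hf : ∀ (a : ℝ) (x : E n), 0 < a → f (a • x) = f x) (w : E n) {a : ℝ} (ha : 0 < a) :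
    orbitAverage e f (a • w) = orbitAverage e f w := by
  unfold orbitAverage
  simp only [rot_smul, hf a _ ha]

/-- The stabiliser of `e` acts transitively on the directions orthogonal to `e`. -/
theorem orbitAverage_eq (e : E n) (f : E n → ENNReal)
    (hf : ∀ (a : ℝ) (x : E n), 0 < a → f (a • x) = f x) {v w : E n} (hv : v ≠ 0) (hw : w ≠ 0)
    (hev : inner ℝ e v = 0) (hew : inner ℝ e w = 0) :
    orbitAverage e f v = orbitAverage e f w := by
  have hv' : 0 < ‖v‖ := norm_pos_iff.2 hv
  have hw' : 0 < ‖w‖ := norm_pos_iff.2 hw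
  obtain ⟨g, hg, hge⟩ := exists_rot_eq (‖v‖⁻¹ • v) (‖w‖⁻¹ • w) (by
    rw [norm_smul, norm_smul, norm_inv, norm_inv, norm_norm, norm_norm,
      inv_mul_cancel₀ hv'.ne', inv_mul_cancel₀ hw'.ne'])
  have hgs : g ∈ stab e := hge e (by simp [inner_sub_right, inner_smul_right, hev, hew])
  rw [← orbitAverage_smul e f hf v (inv_pos.2 hv'), ← orbitAverage_smul e f hf w (inv_pos.2 hw'),
    ← hg]
  exact (orbitAverage_rot e f _ ⟨g, hgs⟩).symm

/-- Joint measurability for Tonelli. Second countability of `O n` makes the product σ-algebra Borel,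
so continuity suffices. -/
theorem measurable_comp_rot_inv (e : E n) {f : E n → ENNReal} (hfm : Measurable f)
    {w : O n → E n} (hwm : Continuous w) :
    Measurable fun z : stab e × O n => f (rot (z.1 : O n)⁻¹ (w z.2)) := by
  apply hfm.comp
  apply Continuous.measurable
  exact continuous_rot.comp (((continuous_subtype_val.comp continuous_fst).inv).prodMk
    (hwm.comp continuous_snd))

/-- Substitute `h⁻¹ * g` for `g` in the Haar integral: the weight does not change and the vector
rotates. -/
theorem lintegral_mul_comp_rot_inv (e : E n) {f : E n → ENNReal}
    {φ : O n → ENNReal} (hφ : ∀ h ∈ stab e, ∀ g, φ (h * g) = φ g)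
    {w : O n → E n} (hw : ∀ h ∈ stab e, ∀ g, w (h * g) = rot h (w g)) (h : stab e) :
    ∫⁻ g, φ g * f (w g) ∂(haarO n) = ∫⁻ g, φ g * f (rot (h : O n)⁻¹ (w g)) ∂(haarO n) := by
  rw [← lintegral_mul_left_eq_self (μ := haarO n) (fun g => φ g * f (w g)) (h : O n)⁻¹]
  congr 1 with g
  rw [hφ _ (inv_mem h.2), hw _ (inv_mem h.2)]

/-- Averaging over the stabiliser of `e` separates an invariant weight from the direction of an
equivariant vector. -/
theorem lintegral_mul_equivariant (e : E n) {f : E n → ENNReal} (hfm : Measurable f)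
    {φ : O n → ENNReal} (hφm : Measurable φ) (hφ : ∀ h ∈ stab e, ∀ g, φ (h * g) = φ g)
    {w : O n → E n} (hwm : Continuous w) (hw : ∀ h ∈ stab e, ∀ g, w (h * g) = rot h (w g)) :
    ∫⁻ g, φ g * f (w g) ∂(haarO n) = ∫⁻ g, φ g * orbitAverage e f (w g) ∂(haarO n) := by
  have hm := measurable_comp_rot_inv e hfm hwm
  have h0 : ∫⁻ g, φ g * f (w g) ∂(haarO n) =
      ∫⁻ h : stab e, ∫⁻ g, φ g * f (rot (h : O n)⁻¹ (w g)) ∂(haarO n) ∂(haarStab e) := by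
    rw [← lintegral_congr (lintegral_mul_comp_rot_inv e (f := f) hφ hw), lintegral_const,
      measure_univ, mul_one]
  have h1 : ∫⁻ h : stab e, ∫⁻ g, φ g * f (rot (h : O n)⁻¹ (w g)) ∂(haarO n) ∂(haarStab e) =
      ∫⁻ g, ∫⁻ h : stab e, φ g * f (rot (h : O n)⁻¹ (w g)) ∂(haarStab e) ∂(haarO n) :=
    lintegral_lintegral_swap ((hφm.comp measurable_snd).mul hm).aemeasurable
  refine (h0.trans h1).trans (lintegral_congr fun g => ?_)
  have hmg : Measurable fun h : stab e => f (rot (h : O n)⁻¹ (w g)) :=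
    Measurable.comp (g := fun z : stab e × O n => f (rot (z.1 : O n)⁻¹ (w z.2))) hm
      (f := fun h : stab e => (h, g)) (measurable_id.prodMk measurable_const)
  rw [lintegral_const_mul (φ g) hmg, orbitAverage]

/-- The orbit average is constant on nonzero vectors orthogonal to `e`, and wherever the weight is
nonzero `w g` is such a vector, so the constant factors out. This is the independence statement
behind the whole bound. -/
theorem lintegral_mul_equivariant_eq_mul (e : E n) {f : E n → ENNReal} (hfm : Measurable f)
    (hf : ∀ (a : ℝ) (x : E n), 0 < a → f (a • x) = f x)
    {φ : O n → ENNReal} (hφm : Measurable φ) (hφ : ∀ h ∈ stab e, ∀ g, φ (h * g) = φ g)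
    {w : O n → E n} (hwm : Continuous w) (hw : ∀ h ∈ stab e, ∀ g, w (h * g) = rot h (w g))
    (hφw : ∀ g, φ g ≠ 0 → w g ≠ 0 ∧ inner ℝ e (w g) = 0)
    {w₀ : E n} (hw₀ : w₀ ≠ 0) (hew₀ : inner ℝ e w₀ = 0) :
    ∫⁻ g, φ g * f (w g) ∂(haarO n) = (∫⁻ g, φ g ∂(haarO n)) * orbitAverage e f w₀ := by
  rw [lintegral_mul_equivariant e hfm hφm hφ hwm hw, ← lintegral_mul_const _ hφm]
  congr 1 with g
  by_cases h : φ g = 0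
  · simp [h]
  · rw [orbitAverage_eq e f hf (hφw g h).1 hw₀ (hφw g h).2 hew₀]

/-- The indicator of the hyperplane orthogonal to `b`. -/
def hyperplaneIndicator (b : E n) : E n → ENNReal := Set.indicator {x | inner ℝ x b = 0} 1

theorem measurable_hyperplaneIndicator (b : E n) : Measurable (hyperplaneIndicator b) := by
  apply measurable_one.indicator
  exact (isClosed_eq (by fun_prop) continuous_const).measurableSet

theorem hyperplaneIndicator_smul (b : E n) (a : ℝ) (x : E n) (ha : 0 < a) :
    hyperplaneIndicator b (a • x) = hyperplaneIndicator b x := by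
  simp [hyperplaneIndicator, Set.indicator_apply, inner_smul_left, ha.ne']

/-- A random direction orthogonal to `e` is almost surely not orthogonal to a given vector outside
the line spanned by `e`. -/
theorem orbitAverage_hyperplaneIndicator (e b : E n) (hb : b ∉ Submodule.span ℝ {e})
    {w : E n} (hw : w ≠ 0) (hew : inner ℝ e w = 0) :
    orbitAverage e (hyperplaneIndicator b) w = 0 := by
  set F := (Submodule.span ℝ {e})ᗮ with hF
  have hmemF : ∀ x, x ∈ F ↔ inner ℝ e x = 0 := fun x =>
    Submodule.mem_orthogonal_singleton_iff_inner_right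
  have hnt : Nontrivial F := ⟨⟨w, (hmemF w).2 hew⟩, 0, fun h => hw (congrArg Subtype.val h)⟩
  have hm : Measurable fun z : F × stab e =>
      hyperplaneIndicator b (rot (z.2 : O n)⁻¹ (z.1 : E n)) := by
    apply (measurable_hyperplaneIndicator b).comp
    apply Continuous.measurable
    exact continuous_rot.comp (((continuous_subtype_val.comp continuous_snd).inv).prodMk
      (continuous_subtype_val.comp continuous_fst))
  -- Instead of a measure on the sphere of `F`, use Lebesgue measure on `F` and swap the integrals:
  -- for each fixed `h` the bad vectors form a proper subspace, which is null.
  have hzero : ∫⁻ x : F, orbitAverage e (hyperplaneIndicator b) x = 0 := by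
    unfold orbitAverage
    rw [lintegral_lintegral_swap hm.aemeasurable]
    apply (lintegral_eq_zero_iff' ?_).2
    · refine Filter.Eventually.of_forall fun h => ?_
      let K : Submodule ℝ F := LinearMap.ker
        (((innerSL ℝ (rot (h : O n) b)).toLinearMap).comp F.subtype)
      -- Otherwise the rotated `b` lies in the line of `e`; since `h` fixes `e`, rotating back puts
      -- `b` there too.
      have hK : K ≠ ⊤ := by
        intro htop
        have hFF : rot (h : O n) b ∈ Fᗮ := by
          rw [Submodule.mem_orthogonal']
          intro u hu
          have : (⟨u, hu⟩ : F) ∈ K := by rw [htop]; trivial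
          simpa [K] using this
        rw [hF, Submodule.orthogonal_orthogonal, Submodule.mem_span_singleton] at hFF
        obtain ⟨a, ha⟩ := hFF
        apply hb
        rw [Submodule.mem_span_singleton]
        refine ⟨a, ?_⟩
        have h2 := congrArg (rot (h : O n)⁻¹) ha
        rw [rot_inv_rot, rot_smul, mem_stab.1 (inv_mem h.2)] at h2
        exact h2
      have h0 := Measure.addHaar_submodule (volume : Measure F) K hK
      have hKm : MeasurableSet (K : Set F) := (K.closed_of_finiteDimensional).measurableSet
      simp only [Pi.zero_apply]
      rw [← h0, ← lintegral_indicator_one hKm]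
      congr 1 with x
      simp only [hyperplaneIndicator, Set.indicator_apply]
      congr 1
      simp only [mem_ofPred_eq, SetLike.mem_coe, K, LinearMap.mem_ker, eq_iff_iff]
      rw [inner_rot_left, inv_inv, real_inner_comm]
      simp
    · exact (hm.comp measurable_swap).lintegral_prod_right'.aemeasurable
  have hae : ∀ᵐ x : F, orbitAverage e (hyperplaneIndicator b) x = 0 :=
    (lintegral_eq_zero_iff' hm.lintegral_prod_right'.aemeasurable).1 hzero
  have hne : ∀ᵐ x : F, x ≠ 0 := by
    rw [ae_iff]; simp
  -- One nonzero `x` with zero average is enough, by transitivity of the stabiliser on directions.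
  obtain ⟨x, hx0, hx1⟩ := (hae.and hne).exists
  rw [← hx0]
  exact orbitAverage_eq e _ (hyperplaneIndicator_smul b) hw (fun h => hx1 (Subtype.ext h)) hew
    ((hmemF x).1 x.2)

/-- Independence with the indicator of `φ` as weight: the other factor is the chance that a random
direction in the orthogonal complement of `e` is orthogonal to `b`, which is zero. -/
theorem ae_inner_ne_zero (e b : E n) (hb : b ∉ Submodule.span ℝ {e}) {φ : Set (O n)}
    (hφm : MeasurableSet φ) (hφ : ∀ h ∈ stab e, ∀ g, h * g ∈ φ ↔ g ∈ φ)
    {w : O n → E n} (hwm : Continuous w) (hw : ∀ h ∈ stab e, ∀ g, w (h * g) = rot h (w g))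
    (hφw : ∀ g ∈ φ, w g ≠ 0 ∧ inner ℝ e (w g) = 0) :
    ∀ᵐ g ∂(haarO n), g ∈ φ → inner ℝ (w g) b ≠ 0 := by
  by_cases hne : ∃ g₀, g₀ ∈ φ
  · obtain ⟨g₀, hg₀⟩ := hne
    have hinv : ∀ h ∈ stab e, ∀ g,
        φ.indicator (1 : O n → ENNReal) (h * g) = φ.indicator 1 g := fun h hh g => by
      by_cases hg : g ∈ φ
      · rw [Set.indicator_of_mem hg, Set.indicator_of_mem ((hφ h hh g).2 hg)]; rfl
      · rw [Set.indicator_of_notMem hg, Set.indicator_of_notMem (mt (hφ h hh g).1 hg)]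
    have h := lintegral_mul_equivariant_eq_mul e (measurable_hyperplaneIndicator b)
      (hyperplaneIndicator_smul b) (φ := φ.indicator 1) (measurable_one.indicator hφm)
      hinv hwm hw
      (fun g hg => hφw g (by
        by_contra hc
        simp [hc] at hg)) (hφw g₀ hg₀).1 (hφw g₀ hg₀).2
    rw [orbitAverage_hyperplaneIndicator e b hb (hφw g₀ hg₀).1 (hφw g₀ hg₀).2, mul_zero] at h
    have h' := (lintegral_eq_zero_iff ((measurable_one.indicator hφm).mul
        ((measurable_hyperplaneIndicator b).comp hwm.measurable))).1 h
    filter_upwards [h'] with g hg hgφ hgb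
    simp [hyperplaneIndicator, hgφ, hgb] at hg
  · exact Filter.Eventually.of_forall fun g hg => (hne ⟨g, hg⟩).elim

/-! ### Upper hulls of finite planar point sets. -/

section Planar

variable {ι : Type*}

/-- `q` and `p` are the left and right end of an edge of the upper hull of the planar points
`(x s, y s)`, and all the other points lie strictly below its line. -/
def IsUpperEdge (S : Finset ι) (x y : ι → ℝ) (p q : ι) : Prop :=
  0 < x p - x q ∧
    ∀ s ∈ S, s ≠ p → s ≠ q → (x p - x q) * (y s - y p) - (y p - y q) * (x s - x p) < 0

open scoped Classical in
/-- The pairs of ends of edges of the upper hull. -/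
def upperEdges (S : Finset ι) (x y : ι → ℝ) : Finset (ι × ι) :=
  (S ×ˢ S).filter fun z => IsUpperEdge S x y z.1 z.2

open scoped Classical in
/-- The points of the upper hull that are exposed by a line that is not vertical. -/
def upperVertices (S : Finset ι) (x y : ι → ℝ) : Finset ι :=
  S.filter fun p => ∃ t : ℝ, ∀ s ∈ S, s ≠ p → y s - t * x s < y p - t * x p

open scoped Classical in
/-- The points that are exposed by some linear functional. -/
def exposedVertices (S : Finset ι) (x y : ι → ℝ) : Finset ι :=
  S.filter fun p => ∃ a b : ℝ, ∀ s ∈ S, s ≠ p → a * x s + b * y s < a * x p + b * y p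

theorem exposedVertices_subset (S : Finset ι) (x y : ι → ℝ) : exposedVertices S x y ⊆ S := by
  classical exact Finset.filter_subset _ _

/-- No two points share a first coordinate and no three are collinear. -/
def InGeneralPosition (S : Finset ι) (x y : ι → ℝ) : Prop :=
  (∀ p ∈ S, ∀ q ∈ S, p ≠ q → x p ≠ x q) ∧
    ∀ p ∈ S, ∀ q ∈ S, ∀ s ∈ S, p ≠ q → s ≠ p → s ≠ q → 0 < x p - x q →
      (x p - x q) * (y s - y p) - (y p - y q) * (x s - x p) ≠ 0

/-- Among the points to the left of `p`, take `q` with the line `qp` of least slope. Points to the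
left then lie below this line by minimality; points to the right do so because the exposing line at
`p` has smaller slope `t`. -/
theorem exists_isUpperEdge {S : Finset ι} {x y : ι → ℝ} (h : InGeneralPosition S x y)
    {p : ι} (hp : p ∈ upperVertices S x y) (hmin : ∃ q ∈ S, x q < x p) :
    ∃ q ∈ S, IsUpperEdge S x y p q := by
  classical
  simp only [upperVertices, Finset.mem_filter] at hp
  obtain ⟨hpS, t, ht⟩ := hp
  obtain ⟨q, hq, hqmin⟩ := Finset.exists_min_image (S.filter fun q => x q < x p)
    (fun q => (y p - y q) / (x p - x q)) (by
      obtain ⟨q, hq, hqp⟩ := hmin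
      exact ⟨q, by simp [hq, hqp]⟩)
  simp only [Finset.mem_filter] at hq hqmin
  obtain ⟨hqS, hqp⟩ := hq
  have hqp' : 0 < x p - x q := sub_pos.2 hqp
  refine ⟨q, hqS, hqp', fun s hs hsp hsq => ?_⟩
  have hne := h.2 p hpS q hqS s hs (by rintro rfl; exact lt_irrefl _ hqp) hsp hsq hqp'
  refine lt_of_le_of_ne ?_ hne
  have hts := ht s hs hsp
  have htq := ht q hqS (by rintro rfl; exact lt_irrefl _ hqp)
  rcases lt_trichotomy (x s) (x p) with hlt | heq | hgt
  · have := hqmin s ⟨hs, hlt⟩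
    rw [div_le_div_iff₀ hqp' (sub_pos.2 hlt)] at this
    nlinarith
  · exact absurd heq (h.1 s hs p hpS hsp)
  · have h1 : (x p - x q) * ((y s - y p) - t * (x s - x p)) < 0 := by
      apply mul_neg_of_pos_of_neg hqp'; linarith
    have h2 : 0 < (x s - x p) * ((y p - y q) - t * (x p - x q)) := by
      apply mul_pos (sub_pos.2 hgt); linarith
    nlinarith

/-- Each upper vertex except the leftmost point is the right end of an upper edge. -/
theorem card_upperVertices_le {S : Finset ι} {x y : ι → ℝ} (h : InGeneralPosition S x y) :
    (upperVertices S x y).card ≤ (upperEdges S x y).card + 1 := by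
  classical
  rcases S.eq_empty_or_nonempty with rfl | hne
  · simp [upperVertices]
  obtain ⟨m, hm, hmin⟩ := Finset.exists_min_image S x hne
  have hsub : upperVertices S x y ⊆ insert m ((upperEdges S x y).image Prod.fst) := by
    intro p hp
    have hpS : p ∈ S := (Finset.mem_filter.1 hp).1
    by_cases hpm : p = m
    · simp [hpm]
    · obtain ⟨q, hq, hpq⟩ := exists_isUpperEdge h hp
        ⟨m, hm, lt_of_le_of_ne (hmin p hpS) (h.1 m hm p hpS (Ne.symm hpm))⟩
      apply Finset.mem_insert_of_mem
      exact Finset.mem_image.2 ⟨(p, q), Finset.mem_filter.2 ⟨by simp [hpS, hq], hpq⟩, rfl⟩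
  exact (Finset.card_le_card hsub).trans ((Finset.card_insert_le _ _).trans
    (Nat.add_le_add_right Finset.card_image_le 1))

/-- The sign of the coefficient `b` of the exposing functional decides between upper hull, lower
hull and, for `b = 0`, the leftmost or rightmost point. The `4` is one extra vertex per hull plus
these two points. -/
theorem card_exposedVertices_le {S : Finset ι} {x y : ι → ℝ} (h : InGeneralPosition S x y)
    (h' : InGeneralPosition S x (-y)) :
    (exposedVertices S x y).card ≤
      (upperEdges S x y).card + (upperEdges S x (-y)).card + 4 := by
  classical
  rcases S.eq_empty_or_nonempty with rfl | hne
  · simp [exposedVertices]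
  obtain ⟨m, hm, hmin⟩ := Finset.exists_min_image S x hne
  obtain ⟨M, hM, hmax⟩ := Finset.exists_max_image S x hne
  have hsub : exposedVertices S x y ⊆
      (upperVertices S x y ∪ upperVertices S x (-y)) ∪ {m, M} := by
    intro p hp
    simp only [exposedVertices, Finset.mem_filter] at hp
    obtain ⟨hpS, a, b, hab⟩ := hp
    simp only [Finset.mem_union, Finset.mem_insert, Finset.mem_singleton, upperVertices,
      Finset.mem_filter, hpS, true_and, Pi.neg_apply]
    rcases lt_trichotomy b 0 with hb | hb | hb
    · left; right
      have hba : b * (a / b) = a := mul_div_cancel₀ _ hb.ne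
      refine ⟨a / b, fun s hs hsp => ?_⟩
      have := hab s hs hsp
      have h3 : (-b) * (-y s - a / b * x s) = a * x s + b * y s := by
        linear_combination x s * hba
      have h4 : (-b) * (-y p - a / b * x p) = a * x p + b * y p := by
        linear_combination x p * hba
      rw [← h3, ← h4] at this
      exact lt_of_mul_lt_mul_left this (by linarith)
    · right
      subst hb
      by_contra hc
      push Not at hc
      have h1 := hab m hm (Ne.symm hc.1)
      have h2 := hab M hM (Ne.symm hc.2)
      have h3 := hmin p hpS
      have h4 := hmax p hpS
      rcases le_total a 0 with ha | ha <;> nlinarith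
    · left; left
      refine ⟨-a / b, fun s hs hsp => ?_⟩
      have := hab s hs hsp
      have h3 : b * (y s - -a / b * x s) = a * x s + b * y s := by field_simp; ring
      have h4 : b * (y p - -a / b * x p) = a * x p + b * y p := by field_simp; ring
      rw [← h3, ← h4] at this
      exact lt_of_mul_lt_mul_left this hb.le
  have h1 := card_upperVertices_le h
  have h2 := card_upperVertices_le h'
  have h3 := (Finset.card_le_card hsub).trans ((Finset.card_union_le _ _).trans
    (Nat.add_le_add (Finset.card_union_le _ _) (Finset.card_le_two)))
  omega

/-- With denominators cleared, this compares heights at abscissa `c`: the chord `q'p'` runs strictly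
below the line `qp`, because at least one of its ends is neither `p` nor `q`. -/
theorem IsUpperEdge.lt_of_ne {S : Finset ι} {x y : ι → ℝ} {p q p' q' : ι}
    (hp' : p' ∈ S) (hq' : q' ∈ S) (h : IsUpperEdge S x y p q) (h' : IsUpperEdge S x y p' q') {c : ℝ}
    (hc' : c ∈ Ioo (x q') (x p')) (hne : ¬ (p = p' ∧ q = q')) :
    (x p - x q) * ((c - x q') * y p' + (x p' - c) * y q') <
      (x p' - x q') * ((c - x q) * y p + (x p - c) * y q) := by
  have hle : ∀ s ∈ S, (x p - x q) * (y s - y p) - (y p - y q) * (x s - x p) ≤ 0 := by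
    intro s hs
    by_cases hsp : s = p
    · subst hsp; simp
    by_cases hsq : s = q
    · subst hsq; apply le_of_eq; ring
    · exact (h.2 s hs hsp hsq).le
  have hlt : (c - x q') * ((x p - x q) * (y p' - y p) - (y p - y q) * (x p' - x p)) +
      (x p' - c) * ((x p - x q) * (y q' - y p) - (y p - y q) * (x q' - x p)) < 0 := by
    have c1 := sub_pos.2 hc'.1
    have c2 := sub_pos.2 hc'.2
    have h0 := h.1
    have h0' := h'.1
    by_cases h1 : p' ≠ p ∧ p' ≠ q
    · exact add_neg_of_neg_of_nonpos (mul_neg_of_pos_of_neg c1 (h.2 p' hp' h1.1 h1.2))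
        (mul_nonpos_of_nonneg_of_nonpos c2.le (hle q' hq'))
    by_cases h2 : q' ≠ p ∧ q' ≠ q
    · exact add_neg_of_nonpos_of_neg (mul_nonpos_of_nonneg_of_nonpos c1.le (hle p' hp'))
        (mul_neg_of_pos_of_neg c2 (h.2 q' hq' h2.1 h2.2))
    exfalso
    rw [not_and_or, not_not, not_not] at h1 h2
    -- Both ends lie in `{p, q}`: the edge is degenerate or reversed, against its positive width, or
    -- is the same edge.
    rcases h1 with rfl | rfl <;> rcases h2 with rfl | rfl
    · linarith
    · exact hne ⟨rfl, rfl⟩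
    · linarith
    · linarith
  linarith

/-- Two different edges over a common abscissa would each lie strictly below the other there. -/
theorem IsUpperEdge.eq_of_mem {S : Finset ι} {x y : ι → ℝ} {p q p' q' : ι}
    (hp : p ∈ S) (hq : q ∈ S) (hp' : p' ∈ S) (hq' : q' ∈ S)
    (h : IsUpperEdge S x y p q) (h' : IsUpperEdge S x y p' q') {c : ℝ}
    (hc : c ∈ Ioo (x q) (x p)) (hc' : c ∈ Ioo (x q') (x p')) : p = p' ∧ q = q' := by
  by_contra hne
  have h1 := h.lt_of_ne hp' hq' h' hc' hne
  have h2 := h'.lt_of_ne hp hq h hc (fun ⟨a, b⟩ => hne ⟨a.symm, b.symm⟩)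
  exact lt_asymm h1 h2

/-- The edges lie over disjoint open intervals contained in an interval of length `D`; compare
Lebesgue measures. -/
theorem sum_upperEdges_le {S : Finset ι} {x y : ι → ℝ} {D : ℝ} (hD0 : 0 ≤ D)
    (hD : ∀ p ∈ S, ∀ q ∈ S, x p - x q ≤ D) :
    ∑ z ∈ upperEdges S x y, (x z.1 - x z.2) ≤ D := by
  classical
  rcases S.eq_empty_or_nonempty with rfl | hne
  · simpa [upperEdges] using hD0
  obtain ⟨m, hm, hmin⟩ := Finset.exists_min_image S x hne
  have hdisj : (upperEdges S x y : Set (ι × ι)).PairwiseDisjoint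
      fun z => Ioo (x z.2) (x z.1) := by
    rintro ⟨p, q⟩ hz ⟨p', q'⟩ hz' hne
    simp only [upperEdges, Finset.coe_filter, Finset.mem_product, mem_ofPred_eq] at hz hz'
    rw [Function.onFun, Set.disjoint_left]
    intro c hc hc'
    obtain ⟨rfl, rfl⟩ := hz.2.eq_of_mem hz.1.1 hz.1.2 hz'.1.1 hz'.1.2 hz'.2 hc hc'
    exact hne rfl
  have hvol := measure_biUnion_finset (μ := (volume : Measure ℝ)) hdisj
    (fun _ _ => measurableSet_Ioo)
  have hle : volume (⋃ z ∈ upperEdges S x y, Ioo (x z.2) (x z.1)) ≤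
      volume (Icc (x m) (x m + D)) := by
    apply measure_mono
    simp only [iUnion_subset_iff]
    intro z hz c hc
    simp only [upperEdges, Finset.mem_filter, Finset.mem_product] at hz
    have := hmin _ hz.1.2
    have := hD _ hz.1.1 _ hm
    exact ⟨by linarith [hc.1], by linarith [hc.2]⟩
  rw [hvol, Real.volume_Icc] at hle
  simp only [Real.volume_Ioo] at hle
  rw [← ENNReal.ofReal_sum_of_nonneg] at hle
  · simpa using (ENNReal.ofReal_le_ofReal_iff (by linarith)).1 hle
  · intro z hz
    exact (Finset.mem_filter.1 hz).2.1.le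

end Planar

/-! ### Vertices of polytopes and of their shadows. -/

theorem IsPolytope.finite_vertices {P : Set (E n)} (hP : IsPolytope P) : (vertices P).Finite := by
  obtain ⟨S, hS, rfl⟩ := hP
  exact hS.subset extremePoints_convexHull_subset

theorem IsPolytope.convexHull_vertices {P : Set (E n)} (hP : IsPolytope P) :
    convexHull ℝ (vertices P) = P := by
  have hfin := hP.finite_vertices
  obtain ⟨S, hS, hPS⟩ := hP
  have hcomp : IsCompact P := hPS ▸ hS.isCompact_convexHull ℝ
  have hconv : Convex ℝ P := hPS ▸ convex_convexHull ℝ S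
  have h := closure_convexHull_extremePoints hcomp hconv
  exact (hfin.isClosed_convexHull ℝ).closure_eq.symm.trans h

/-- On a common line `s = p + a (p - q)`, and the position of `a` relative to `-1` and `0` tells
which point lies strictly between the other two, contradicting its extremality, or makes `s`
coincide with `p` or `q`. -/
theorem sub_notMem_span_of_vertices {P : Set (E n)} {p q s : E n} (hp : p ∈ vertices P)
    (hq : q ∈ vertices P) (hs : s ∈ vertices P) (hsp : s ≠ p) (hsq : s ≠ q) :
    s - p ∉ Submodule.span ℝ {p - q} := by
  rw [Submodule.mem_span_singleton]
  rintro ⟨a, ha⟩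
  have hs' : s = p + a • (p - q) := by rw [ha]; abel
  rcases lt_trichotomy a 0 with h | h | h
  · rcases lt_trichotomy a (-1) with h1 | h1 | h1
    · have ha0 : -a ≠ 0 := by linarith
      have ha1 : a * a⁻¹ = 1 := mul_inv_cancel₀ h.ne
      have hmem : q ∈ openSegment ℝ s p := by
        refine ⟨1 / (-a), (-(1 + a)) / (-a), ?_, ?_, ?_, ?_⟩
        · apply div_pos <;> linarith
        · apply div_pos <;> linarith
        · rw [← add_div, div_eq_one_iff_eq ha0]; ring
        · rw [hs']
          match_scalars <;> ring_nf; rw [ha1]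
      exact hsq (hq.2 hs.1 hp.1 hmem)
    · apply hsq; rw [hs', h1]; module
    · have hmem : s ∈ openSegment ℝ p q := by
        refine ⟨1 + a, -a, by linarith, by linarith, by ring, ?_⟩
        rw [hs']; module
      exact hsp (hs.2 hp.1 hq.1 hmem).symm
  · apply hsp; rw [hs', h]; simp
  · have hmem : p ∈ openSegment ℝ s q := by
      refine ⟨1 / (1 + a), a / (1 + a), by positivity, by positivity, by field_simp, ?_⟩
      rw [hs']
      match_scalars <;> field_simp; ring
    exact hsp (hp.2 hs.1 hq.1 hmem)

/-- The extreme points of the convex hull of a finite planar set are its points that are exposed by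
a linear functional. -/
theorem mem_vertices_convexHull_iff {Z : Set (E 2)} (hZ : Z.Finite) {z : E 2} (hz : z ∈ Z) :
    z ∈ vertices (convexHull ℝ Z) ↔
      ∃ a b : ℝ, ∀ y ∈ Z, y ≠ z → a * y 0 + b * y 1 < a * z 0 + b * z 1 := by
  constructor
  · intro h
    have hdiff := ((convex_convexHull ℝ Z).mem_extremePoints_iff_convex_sdiff.1 h).2
    -- Extremality leaves the hull convex after removing `z`, so the hull of the other points misses
    -- `z` and can be separated from it.
    have hnot : z ∉ convexHull ℝ (Z \ {z}) := by
      intro hc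
      have hsub : convexHull ℝ (Z \ {z}) ⊆ convexHull ℝ Z \ {z} :=
        convexHull_min (sdiff_subset_sdiff_left (subset_convexHull ℝ Z)) hdiff
      exact (hsub hc).2 rfl
    obtain ⟨f, u, hfz, hfu⟩ := geometric_hahn_banach_point_closed
      (convex_convexHull ℝ (Z \ {z})) ((hZ.subset sdiff_subset).isClosed_convexHull ℝ) hnot
    have hf : ∀ y : E 2, f y = f (EuclideanSpace.single 0 1) * y 0 +
        f (EuclideanSpace.single 1 1) * y 1 := by
      intro y
      have hy : y = y 0 • EuclideanSpace.single (0 : Fin 2) (1 : ℝ) +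
          y 1 • EuclideanSpace.single (1 : Fin 2) (1 : ℝ) := by
        ext i; fin_cases i <;> simp
      conv_lhs => rw [hy]
      simp [mul_comm]
    refine ⟨-f (EuclideanSpace.single 0 1), -f (EuclideanSpace.single 1 1), fun y hy hyz => ?_⟩
    have := hfu y (subset_convexHull ℝ _ ⟨hy, hyz⟩)
    rw [hf] at this hfz
    linarith
  · rintro ⟨a, b, hab⟩
    let l : StrongDual ℝ (E 2) := innerSL ℝ (!₂[a, b] : E 2)
    have hl : ∀ y : E 2, l y = a * y 0 + b * y 1 := by
      intro y
      simp [l, PiLp.inner_apply, Fin.sum_univ_two, mul_comm]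
    have hle : ∀ y ∈ convexHull ℝ Z, l y ≤ l z := by
      intro y hy
      have hconv : Convex ℝ {y | l y ≤ l z} := convex_halfSpace_le l.isLinear _
      refine convexHull_min (fun x hx => ?_) hconv hy
      by_cases hxz : x = z
      · simp [hxz]
      · have := hab x hx hxz
        simp only [mem_ofPred_eq, hl]
        exact this.le
    have hexp : IsExposed ℝ (convexHull ℝ Z) (l.toExposed (convexHull ℝ Z)) :=
      ContinuousLinearMap.toExposed.isExposed
    have hcomp := hexp.isCompact (hZ.isCompact_convexHull ℝ)
    have hne : (l.toExposed (convexHull ℝ Z)).Nonempty := ⟨z, subset_convexHull ℝ Z hz, hle⟩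
    -- The face where `l` is maximal has an extreme point; it is extreme in the whole hull, so it
    -- belongs to `Z` and can only be `z`.
    obtain ⟨x, hx⟩ := hcomp.extremePoints_nonempty hne
    have hxv : x ∈ vertices (convexHull ℝ Z) :=
      hexp.isExtreme.extremePoints_subset_extremePoints hx
    have hxZ : x ∈ Z := extremePoints_convexHull_subset hxv
    have hxz : x = z := by
      by_contra hxz
      have h1 := hab x hxZ hxz
      have h2 := hx.1.2 z (subset_convexHull ℝ Z hz)
      rw [hl, hl] at h2
      linarith
    exact hxz ▸ hxv

/-- The projection to the plane as a linear map. -/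
def projLinear (U V : E n) : E n →ₗ[ℝ] E 2 where
  toFun := proj U V
  map_add' x y := by ext i; fin_cases i <;> simp [proj, inner_add_right]
  map_smul' a x := by ext i; fin_cases i <;> simp [proj, inner_smul_right]

/-- Distinct first coordinates make the projection injective on `S`, so planar vertices can be
counted by their preimages. -/
theorem ncard_vertices_shadow {S : Finset (E n)} {U V : E n}
    (hinj : ∀ p ∈ S, ∀ q ∈ S, p ≠ q → (inner ℝ U p : ℝ) ≠ inner ℝ U q) :
    (vertices (shadow (convexHull ℝ (S : Set (E n))) U V)).ncard =
      (exposedVertices S (fun p => inner ℝ U p) (fun p => inner ℝ V p)).card := by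
  have hsh : shadow (convexHull ℝ (S : Set (E n))) U V = convexHull ℝ (proj U V '' S) :=
    (projLinear U V).image_convexHull S
  have hproj : Set.InjOn (proj U V) (S : Set (E n)) := by
    intro p hp q hq hpq
    by_contra hne
    apply hinj p hp q hq hne
    simpa [proj] using congrArg (fun z : E 2 => z 0) hpq
  have hset : vertices (shadow (convexHull ℝ (S : Set (E n))) U V) = proj U V ''
      (exposedVertices S (fun p => inner ℝ U p) (fun p => inner ℝ V p) : Finset (E n)) := by
    rw [hsh]
    have hfin : (proj U V '' (S : Set (E n))).Finite := S.finite_toSet.image _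
    have key : ∀ p ∈ S, proj U V p ∈ vertices (convexHull ℝ (proj U V '' (S : Set (E n)))) ↔
        p ∈ exposedVertices S (fun p => inner ℝ U p) (fun p => inner ℝ V p) := by
      intro p hp
      rw [mem_vertices_convexHull_iff hfin (mem_image_of_mem _ hp)]
      simp only [exposedVertices, Finset.mem_filter, hp, true_and]
      refine exists_congr fun a => exists_congr fun b => ?_
      rw [forall_mem_image]
      refine forall₂_congr fun s hs => ?_
      rw [hproj.ne_iff hs hp]
      simp [proj]
    ext z
    constructor
    · intro hz
      obtain ⟨p, hp, rfl⟩ := extremePoints_convexHull_subset hz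
      exact ⟨p, (key p hp).1 hz, rfl⟩
    · rintro ⟨p, hp, rfl⟩
      have hpS : p ∈ S := exposedVertices_subset S _ _ hp
      exact (key p hpS).2 hp
  have hsub := exposedVertices_subset S (fun p => (inner ℝ U p : ℝ)) (fun p => inner ℝ V p)
  rw [hset, InjOn.ncard_image, ncard_coe_finset]
  exact hproj.mono (Finset.coe_subset.2 hsub)

/-! ### The constant `κ`, the mean of `⟨U, e⟩⁺` for a unit vector `e`. -/

section Kappa

/-- The mean positive part of the inner product of a random unit vector with `e`. -/
def meanPos (i : Fin n) (e : E n) : ENNReal :=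
  ∫⁻ g, ENNReal.ofReal (inner ℝ (column g i) e) ∂(haarO n)

theorem continuous_inner_column (i : Fin n) (e : E n) :
    Continuous fun g : O n => (inner ℝ (column g i) e : ℝ) :=
  (continuous_column i).inner continuous_const

theorem measurable_ofReal_inner_column (i : Fin n) (e : E n) :
    Measurable fun g : O n => ENNReal.ofReal (inner ℝ (column g i) e) :=
  (continuous_inner_column i e).measurable.ennreal_ofReal

theorem meanPos_eq_of_norm_eq (i : Fin n) {e e' : E n} (h : ‖e‖ = ‖e'‖) :
    meanPos i e = meanPos i e' := by
  obtain ⟨k, rfl, -⟩ := exists_rot_eq e e' h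
  unfold meanPos
  rw [← lintegral_mul_left_eq_self (μ := haarO n) (fun g => ENNReal.ofReal
    (inner ℝ (column g i) (rot k e))) k]
  simp only [column_mul, inner_rot_rot]

theorem meanPos_smul (i : Fin n) {a : ℝ} (ha : 0 ≤ a) (e : E n) :
    meanPos i (a • e) = ENNReal.ofReal a * meanPos i e := by
  unfold meanPos
  rw [← lintegral_const_mul _ (measurable_ofReal_inner_column i e)]
  simp only [inner_smul_right, ENNReal.ofReal_mul ha]

theorem meanPos_eq (i : Fin n) (e : E n) :
    meanPos i e = ENNReal.ofReal ‖e‖ * meanPos i (EuclideanSpace.single i 1) := by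
  rw [← meanPos_smul i (norm_nonneg e)]
  apply meanPos_eq_of_norm_eq
  simp [norm_smul]

theorem norm_column (g : O n) (i : Fin n) : ‖column g i‖ = 1 := by
  have := inner_column g i i
  rw [if_pos rfl, real_inner_self_eq_norm_sq] at this
  exact (pow_eq_one_iff_of_nonneg (norm_nonneg _) two_ne_zero).1 this

/-- Each `|t|` is `t⁺ + (-t)⁺`, and the `2n` signed basis vectors all have the same `meanPos`.
Expressing the mean width through `κ` makes its value irrelevant. -/
theorem lintegral_sum_abs_column (i : Fin n) :
    ∫⁻ g, ENNReal.ofReal (∑ j, |column g i j|) ∂(haarO n) =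
      2 * n * meanPos i (EuclideanSpace.single i 1) := by
  have h : ∀ g : O n, ENNReal.ofReal (∑ j, |column g i j|) =
      ∑ j, (ENNReal.ofReal (inner ℝ (column g i) (EuclideanSpace.single j 1)) +
        ENNReal.ofReal (inner ℝ (column g i) (EuclideanSpace.single j (-1)))) := by
    intro g
    rw [ENNReal.ofReal_sum_of_nonneg fun j _ => abs_nonneg _]
    refine Finset.sum_congr rfl fun j _ => ?_
    simp only [EuclideanSpace.inner_single_right, conj_trivial, one_mul, neg_mul]
    rcases le_total 0 (column g i j) with hc | hc
    · rw [abs_of_nonneg hc, ENNReal.ofReal_of_nonpos (by linarith : -(column g i j) ≤ 0), add_zero]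
    · rw [abs_of_nonpos hc, ENNReal.ofReal_of_nonpos hc, zero_add]
  simp only [h]
  have hm : ∀ j, Measurable fun g : O n =>
      (ENNReal.ofReal (inner ℝ (column g i) (EuclideanSpace.single j 1)) +
        ENNReal.ofReal (inner ℝ (column g i) (EuclideanSpace.single j (-1)))) := fun j =>
    (measurable_ofReal_inner_column i _).add (measurable_ofReal_inner_column i _)
  rw [lintegral_finsetSum _ fun j _ => hm j]
  have h2 : ∀ j, ∫⁻ g, (ENNReal.ofReal (inner ℝ (column g i) (EuclideanSpace.single j 1)) +
        ENNReal.ofReal (inner ℝ (column g i) (EuclideanSpace.single j (-1)))) ∂(haarO n) =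
      2 * meanPos i (EuclideanSpace.single i 1) := by
    intro j
    rw [lintegral_add_left (measurable_ofReal_inner_column i _), two_mul]
    congr 1 <;> exact meanPos_eq_of_norm_eq i (by simp)
  simp only [h2, Finset.sum_const, Finset.card_univ, Fintype.card_fin, nsmul_eq_mul]
  ring

theorem meanPos_single_ne_top (i : Fin n) : meanPos i (EuclideanSpace.single i 1) ≠ ⊤ := by
  have : meanPos i (EuclideanSpace.single i 1) ≤ ∫⁻ _, 1 ∂(haarO n) := by
    apply lintegral_mono
    intro g
    rw [← ENNReal.ofReal_one]
    apply ENNReal.ofReal_le_ofReal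
    refine (real_inner_le_norm _ _).trans ?_
    simp [norm_column]
  exact (this.trans_lt (by simp)).ne

/-- The `ℓ¹` norm of a unit vector is at least its squared `ℓ²` norm, so its mean, a multiple of
`κ`, is at least one. -/
theorem meanPos_single_ne_zero (i : Fin n) : meanPos i (EuclideanSpace.single i 1) ≠ 0 := by
  intro h0
  have h := lintegral_sum_abs_column i
  rw [h0, mul_zero] at h
  have h1 : ∫⁻ _, 1 ∂(haarO n) ≤ ∫⁻ g, ENNReal.ofReal (∑ j, |column g i j|) ∂(haarO n) := by
    apply lintegral_mono
    intro g
    rw [← ENNReal.ofReal_one]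
    apply ENNReal.ofReal_le_ofReal
    have h2 := norm_column g i
    have h3 : ∑ j, (column g i j) ^ 2 = 1 := by
      have := EuclideanSpace.real_norm_sq_eq (column g i)
      rw [h2] at this
      linarith
    rw [← h3]
    refine Finset.sum_le_sum fun j _ => ?_
    have h4 : |column g i j| ≤ 1 := by
      have := PiLp.norm_apply_le (column g i) j
      rwa [h2] at this
    rw [← sq_abs]
    nlinarith [abs_nonneg (column g i j)]
  rw [h] at h1
  simp at h1

end Kappa

/-! ### The probability that a given segment projects to an edge. -/

section Edges

/-- A vector of the random plane orthogonal to `e`. -/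
def normalVector (i j : Fin n) (e : E n) (g : O n) : E n :=
  (inner ℝ (column g i) e : ℝ) • column g j - (inner ℝ (column g j) e : ℝ) • column g i

theorem continuous_normalVector (i j : Fin n) (e : E n) : Continuous (normalVector i j e) :=
  ((continuous_inner_column i e).smul (continuous_column j)).sub
    ((continuous_inner_column j e).smul (continuous_column i))

theorem inner_column_mul {e : E n} {h : O n} (hh : h ∈ stab e) (g : O n) (i : Fin n) :
    (inner ℝ (column (h * g) i) e : ℝ) = inner ℝ (column g i) e := by
  rw [column_mul, inner_rot_left, mem_stab.1 (inv_mem hh)]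

theorem normalVector_mul (i j : Fin n) {e : E n} {h : O n} (hh : h ∈ stab e) (g : O n) :
    normalVector i j e (h * g) = rot h (normalVector i j e g) := by
  rw [normalVector, inner_column_mul hh, inner_column_mul hh, column_mul, column_mul, normalVector,
    rot_sub, rot_smul, rot_smul]

theorem inner_normalVector (i j : Fin n) (e : E n) (g : O n) :
    inner ℝ e (normalVector i j e g) = 0 := by
  simp only [normalVector, inner_sub_right, inner_smul_right]
  rw [real_inner_comm e, real_inner_comm e]
  ring

/-- Its inner product with column `j` is `⟨column g i, e⟩`. -/
theorem normalVector_ne_zero {i j : Fin n} (hij : i ≠ j) {e : E n} {g : O n}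
    (h : 0 < (inner ℝ (column g i) e : ℝ)) : normalVector i j e g ≠ 0 := by
  intro h0
  have h1 : inner ℝ (normalVector i j e g) (column g j) = 0 := by rw [h0, inner_zero_left]
  simp only [normalVector, inner_sub_left, real_inner_smul_left, inner_column, hij] at h1
  simp at h1
  exact h.ne' h1

/-- The outer normals of the edge of the convex hull of `S` from `p` to `q`. -/
def edgeNormals (S : Finset (E n)) (c : ℝ) (p q : E n) : Set (E n) :=
  {w | ∀ s ∈ S, s ≠ p → s ≠ q → c * inner ℝ w (s - p) < 0}

theorem measurableSet_edgeNormals (S : Finset (E n)) (c : ℝ) (p q : E n) :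
    MeasurableSet (edgeNormals S c p q) := by
  have : edgeNormals S c p q =
      ⋂ s ∈ S, ⋂ (_ : s ≠ p), ⋂ (_ : s ≠ q), {w | c * inner ℝ w (s - p) < 0} := by
    ext w; simp [edgeNormals]
  rw [this]
  refine Finset.measurableSet_biInter _ fun s _ => MeasurableSet.iInter fun _ =>
    MeasurableSet.iInter fun _ => ?_
  exact (isOpen_lt (by fun_prop) continuous_const).measurableSet

theorem smul_mem_edgeNormals (S : Finset (E n)) (c : ℝ) (p q : E n) {a : ℝ} (ha : 0 < a)
    (w : E n) : a • w ∈ edgeNormals S c p q ↔ w ∈ edgeNormals S c p q := by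
  refine forall₂_congr fun s _ => forall₂_congr fun _ _ => ?_
  rw [real_inner_smul_left, mul_left_comm]
  exact smul_neg_iff_of_pos_left ha

/-- The rotations for which the segment from `p` to `q` projects to an upper (`c = 1`) or lower
(`c = -1`) edge of the shadow of the convex hull of `S`. -/
def edgeEvent (S : Finset (E n)) (i j : Fin n) (c : ℝ) (p q : E n) : Set (O n) :=
  {g | IsUpperEdge S (fun s => inner ℝ (column g i) s) (fun s => c * inner ℝ (column g j) s) p q}

/-- The planar orientation determinant is linear in `s - p`; this turns the edge condition into one
on the direction of the normal vector alone. -/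
theorem turn_eq_inner_normalVector (i j : Fin n) (c : ℝ) (p q s : E n) (g : O n) :
    (inner ℝ (column g i) p - inner ℝ (column g i) q) *
        (c * inner ℝ (column g j) s - c * inner ℝ (column g j) p) -
      (c * inner ℝ (column g j) p - c * inner ℝ (column g j) q) *
        (inner ℝ (column g i) s - inner ℝ (column g i) p) =
      c * inner ℝ (normalVector i j (p - q) g) (s - p) := by
  simp only [normalVector, inner_sub_left, inner_sub_right, real_inner_smul_left]
  ring

theorem mem_edgeEvent {S : Finset (E n)} {i j : Fin n} {c : ℝ} {p q : E n} {g : O n} :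
    g ∈ edgeEvent S i j c p q ↔ 0 < (inner ℝ (column g i) (p - q) : ℝ) ∧
      normalVector i j (p - q) g ∈ edgeNormals S c p q := by
  simp only [edgeEvent, IsUpperEdge, mem_ofPred_eq, turn_eq_inner_normalVector, inner_sub_right,
    edgeNormals]

theorem measurableSet_edgeEvent (S : Finset (E n)) (i j : Fin n) (c : ℝ) (p q : E n) :
    MeasurableSet (edgeEvent S i j c p q) := by
  have : edgeEvent S i j c p q = {g | 0 < (inner ℝ (column g i) (p - q) : ℝ)} ∩
      normalVector i j (p - q) ⁻¹' edgeNormals S c p q := by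
    ext g; exact mem_edgeEvent
  rw [this]
  exact (isOpen_lt continuous_const (continuous_inner_column i _)).measurableSet.inter
    ((continuous_normalVector i j _).measurable (measurableSet_edgeNormals S c p q))

/-- The probability of an edge is controlled by its mean projected length. -/
theorem measure_edgeEvent_mul_le (S : Finset (E n)) {i j : Fin n} (hij : i ≠ j) (c : ℝ)
    (p q : E n) :
    haarO n (edgeEvent S i j c p q) * meanPos i (p - q) ≤
      ∫⁻ g, (edgeEvent S i j c p q).indicator
        (fun g => ENNReal.ofReal (inner ℝ (column g i) (p - q))) g ∂(haarO n) := by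
  set e := p - q with he
  set A : Set (O n) := {g | 0 < (inner ℝ (column g i) e : ℝ)} with hA
  set f : E n → ENNReal := (edgeNormals S c p q).indicator 1 with hf
  have hAm : MeasurableSet A :=
    (isOpen_lt continuous_const (continuous_inner_column i _)).measurableSet
  have hfm : Measurable f := measurable_one.indicator (measurableSet_edgeNormals S c p q)
  have hfs : ∀ (a : ℝ) (x : E n), 0 < a → f (a • x) = f x := by
    intro a x ha
    by_cases hx : x ∈ edgeNormals S c p q
    · rw [hf, indicator_of_mem hx, indicator_of_mem ((smul_mem_edgeNormals S c p q ha x).2 hx)]; rfl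
    · rw [hf, indicator_of_notMem hx,
        indicator_of_notMem (mt (smul_mem_edgeNormals S c p q ha x).1 hx)]
  have hnv : ∀ g ∈ A, normalVector i j e g ≠ 0 ∧ inner ℝ e (normalVector i j e g) = 0 :=
    fun g hg => ⟨normalVector_ne_zero hij hg, inner_normalVector i j e g⟩
  by_cases hne : A.Nonempty
  swap
  · have : edgeEvent S i j c p q = ∅ := by
      rw [eq_empty_iff_forall_notMem]
      intro g hg
      exact hne ⟨g, (mem_edgeEvent.1 hg).1⟩
    simp [this]
  obtain ⟨g₀, hg₀⟩ := hne
  -- Applied to the indicator of `A` and to the positive part of `⟨U, e⟩`, with the same orbit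
  -- average, which is the conditional probability of an edge given `A`.
  have key : ∀ φ : O n → ENNReal, Measurable φ → (∀ h ∈ stab e, ∀ g, φ (h * g) = φ g) →
      (∀ g, φ g ≠ 0 → g ∈ A) → ∫⁻ g, φ g * f (normalVector i j e g) ∂(haarO n) =
        (∫⁻ g, φ g ∂(haarO n)) * orbitAverage e f (normalVector i j e g₀) := by
    intro φ hφm hφ hφA
    exact lintegral_mul_equivariant_eq_mul e hfm hfs hφm hφ (continuous_normalVector i j e)
      (fun h hh g => normalVector_mul i j hh g) (fun g hg => hnv g (hφA g hg))
      (hnv g₀ hg₀).1 (hnv g₀ hg₀).2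
  have h1 := key (A.indicator 1) (measurable_one.indicator hAm) (by
    intro h hh g
    simp only [hA, indicator_apply, mem_ofPred_eq, inner_column_mul hh, Pi.one_apply]) (by
    intro g hg
    by_contra hc
    exact hg (indicator_of_notMem hc _))
  have h2 := key (fun g => ENNReal.ofReal (inner ℝ (column g i) e))
    (measurable_ofReal_inner_column i e) (by
    intro h hh g
    simp only [inner_column_mul hh]) (by
    intro g hg
    by_contra hc
    exact hg (ENNReal.ofReal_of_nonpos (not_lt.1 hc)))
  have e1 : ∫⁻ g, A.indicator 1 g * f (normalVector i j e g) ∂(haarO n) =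
      haarO n (edgeEvent S i j c p q) := by
    rw [← lintegral_indicator_one (measurableSet_edgeEvent S i j c p q)]
    refine lintegral_congr fun g => ?_
    by_cases hg : g ∈ A <;> by_cases hw : normalVector i j e g ∈ edgeNormals S c p q
    · rw [indicator_of_mem hg, hf, indicator_of_mem hw, indicator_of_mem (mem_edgeEvent.2 ⟨hg, hw⟩)]
      simp
    · rw [hf, indicator_of_notMem hw, indicator_of_notMem (fun h => hw (mem_edgeEvent.1 h).2)]
      simp
    · rw [indicator_of_notMem hg, indicator_of_notMem (fun h => hg (mem_edgeEvent.1 h).1)]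
      simp
    · rw [indicator_of_notMem hg, indicator_of_notMem (fun h => hg (mem_edgeEvent.1 h).1)]
      simp
  have e2 : ∫⁻ g, ENNReal.ofReal (inner ℝ (column g i) e) * f (normalVector i j e g) ∂(haarO n) =
      ∫⁻ g, (edgeEvent S i j c p q).indicator
        (fun g => ENNReal.ofReal (inner ℝ (column g i) e)) g ∂(haarO n) := by
    refine lintegral_congr fun g => ?_
    by_cases hw : normalVector i j e g ∈ edgeNormals S c p q
    · rw [hf, indicator_of_mem hw, Pi.one_apply, mul_one]
      by_cases hg : g ∈ A
      · rw [indicator_of_mem (mem_edgeEvent.2 ⟨hg, hw⟩)]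
      · rw [indicator_of_notMem (fun h => hg (mem_edgeEvent.1 h).1),
          ENNReal.ofReal_of_nonpos (not_lt.1 hg)]
    · rw [hf, indicator_of_notMem hw, indicator_of_notMem (fun h => hw (mem_edgeEvent.1 h).2),
        mul_zero]
  rw [← e2, h2, ← e1, h1, lintegral_indicator_one hAm]
  change _ ≤ meanPos i e * _
  -- The factor `haarO n A` is simply bounded by one.
  calc haarO n A * orbitAverage e f (normalVector i j e g₀) * meanPos i e
      ≤ 1 * orbitAverage e f (normalVector i j e g₀) * meanPos i e := by
        gcongr
        exact prob_le_one
    _ = _ := by rw [one_mul, mul_comm]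

end Edges

/-! ### Expected number of hull edges of a lattice polytope in the cube. -/

theorem one_le_norm_sub_of_int {p q : E n} (hp : ∀ i, ∃ z : ℤ, p i = z)
    (hq : ∀ i, ∃ z : ℤ, q i = z) (hpq : p ≠ q) : 1 ≤ ‖p - q‖ := by
  obtain ⟨i, hi⟩ : ∃ i, p i ≠ q i := by
    by_contra! h
    exact hpq (PiLp.ext h)
  obtain ⟨a, ha⟩ := hp i
  obtain ⟨b, hb⟩ := hq i
  have h1 : (1 : ℝ) ≤ |p i - q i| := by
    rw [ha, hb] at hi ⊢
    have : a - b ≠ 0 := sub_ne_zero.2 fun h => hi (by rw [h])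
    have h : (1 : ℝ) ≤ ((|a - b| : ℤ) : ℝ) := by exact_mod_cast Int.one_le_abs this
    simpa using h
  exact h1.trans (PiLp.norm_apply_le (p - q) i)

/-- Hölder between `ℓ^∞` and `ℓ¹`; this is where the side of the cube enters. -/
theorem inner_sub_le_of_mem_cube {k : ℕ} {p q : E n} (hp : ∀ i, p i ∈ Icc (0 : ℝ) k)
    (hq : ∀ i, q i ∈ Icc (0 : ℝ) k) (U : E n) :
    (inner ℝ U p - inner ℝ U q : ℝ) ≤ k * ∑ i, |U i| := by
  rw [← inner_sub_right, PiLp.inner_apply, Finset.mul_sum]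
  refine Finset.sum_le_sum fun i _ => ?_
  have h1 : |p i - q i| ≤ k := by
    rw [abs_le]
    constructor <;> linarith [(hp i).1, (hp i).2, (hq i).1, (hq i).2]
  calc (inner ℝ (U i) ((p - q) i) : ℝ) ≤ |(p i - q i) * U i| := le_abs_self _
    _ = |p i - q i| * |U i| := abs_mul _ _
    _ ≤ k * |U i| := by gcongr

/-- Multiply by `κ`: each term is at most the mean horizontal length on its event, these lengths sum
to at most the width of the shadow, and the mean width again carries a factor `κ`, which is positive
and finite and cancels. -/
theorem sum_measure_edgeEvent_le (S : Finset (E n)) {i j : Fin n} (hij : i ≠ j) (c : ℝ) {k : ℕ}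
    (hS : ∀ p ∈ S, ∀ l, ∃ z : ℤ, p l = z) (hk : ∀ p ∈ S, ∀ l, p l ∈ Icc (0 : ℝ) k) :
    ∑ z ∈ S ×ˢ S, haarO n (edgeEvent S i j c z.1 z.2) ≤ 2 * n * k := by
  classical
  set κ := meanPos i (EuclideanSpace.single i (1 : ℝ)) with hκ
  have h1 : ∀ z ∈ S ×ˢ S, haarO n (edgeEvent S i j c z.1 z.2) * κ ≤
      ∫⁻ g, (edgeEvent S i j c z.1 z.2).indicator
        (fun g => ENNReal.ofReal (inner ℝ (column g i) (z.1 - z.2))) g ∂(haarO n) := by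
    intro z hz
    rw [Finset.mem_product] at hz
    by_cases hzz : z.1 = z.2
    · have : edgeEvent S i j c z.1 z.2 = ∅ := by
        rw [eq_empty_iff_forall_notMem]
        intro g hg
        have := (mem_edgeEvent.1 hg).1
        rw [hzz, sub_self, inner_zero_right] at this
        exact lt_irrefl _ this
      simp [this]
    · refine le_trans ?_ (measure_edgeEvent_mul_le S hij c z.1 z.2)
      rw [meanPos_eq i (z.1 - z.2)]
      have h2 := one_le_norm_sub_of_int (hS _ hz.1) (hS _ hz.2) hzz
      have h3 : 1 ≤ ENNReal.ofReal ‖z.1 - z.2‖ := by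
        rw [← ENNReal.ofReal_one]; exact ENNReal.ofReal_le_ofReal h2
      calc haarO n (edgeEvent S i j c z.1 z.2) * κ
          = haarO n (edgeEvent S i j c z.1 z.2) * (1 * κ) := by rw [one_mul]
        _ ≤ _ := by gcongr
  have h2 : ∀ g : O n, ∑ z ∈ S ×ˢ S, (edgeEvent S i j c z.1 z.2).indicator
        (fun g => ENNReal.ofReal (inner ℝ (column g i) (z.1 - z.2))) g ≤
      k * ENNReal.ofReal (∑ l, |column g i l|) := by
    intro g
    have hD := sum_upperEdges_le (S := S) (x := fun s => (inner ℝ (column g i) s : ℝ))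
      (y := fun s => c * inner ℝ (column g j) s) (D := k * ∑ l, |column g i l|)
      (by positivity) (fun p hp q hq => inner_sub_le_of_mem_cube (hk p hp) (hk q hq) _)
    rw [← ENNReal.ofReal_natCast, ← ENNReal.ofReal_mul (Nat.cast_nonneg k)]
    refine le_trans (le_of_eq ?_) (ENNReal.ofReal_le_ofReal hD)
    rw [ENNReal.ofReal_sum_of_nonneg, upperEdges, Finset.sum_filter]
    · refine Finset.sum_congr rfl fun z _ => ?_
      rw [indicator_apply, inner_sub_right]
      rfl
    · intro z hz
      exact (Finset.mem_filter.1 hz).2.1.le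
  have h3 : (∑ z ∈ S ×ˢ S, haarO n (edgeEvent S i j c z.1 z.2)) * κ ≤ (2 * n * k) * κ := by
    calc (∑ z ∈ S ×ˢ S, haarO n (edgeEvent S i j c z.1 z.2)) * κ
        = ∑ z ∈ S ×ˢ S, haarO n (edgeEvent S i j c z.1 z.2) * κ := Finset.sum_mul _ _ _
      _ ≤ ∑ z ∈ S ×ˢ S, ∫⁻ g, (edgeEvent S i j c z.1 z.2).indicator
          (fun g => ENNReal.ofReal (inner ℝ (column g i) (z.1 - z.2))) g ∂(haarO n) :=
          Finset.sum_le_sum h1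
      _ = ∫⁻ g, ∑ z ∈ S ×ˢ S, (edgeEvent S i j c z.1 z.2).indicator
          (fun g => ENNReal.ofReal (inner ℝ (column g i) (z.1 - z.2))) g ∂(haarO n) := by
          rw [lintegral_finsetSum]
          intro z _
          exact (measurable_ofReal_inner_column i _).indicator (measurableSet_edgeEvent S i j c _ _)
      _ ≤ ∫⁻ g, k * ENNReal.ofReal (∑ l, |column g i l|) ∂(haarO n) := lintegral_mono h2
      _ = k * ∫⁻ g, ENNReal.ofReal (∑ l, |column g i l|) ∂(haarO n) :=
          lintegral_const_mul' _ _ (ENNReal.natCast_ne_top k)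
      _ = (2 * n * k) * κ := by rw [lintegral_sum_abs_column]; ring
  exact (ENNReal.mul_le_mul_iff_left (meanPos_single_ne_zero i) (meanPos_single_ne_top i)).1 h3

/-! ### Almost sure general position. -/

theorem ae_inner_column_ne (i : Fin n) {p q : E n} (hpq : p ≠ q) :
    ∀ᵐ g ∂(haarO n), (inner ℝ (column g i) p : ℝ) ≠ inner ℝ (column g i) q := by
  -- For `e = 0` the stabiliser is all of `O(n)`, so column `i` itself serves as the random
  -- direction.
  have h := ae_inner_ne_zero (0 : E n) (p - q) (by
      rw [Submodule.span_zero_singleton, Submodule.mem_bot]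
      exact sub_ne_zero.2 hpq) (φ := univ) MeasurableSet.univ (fun _ _ _ => by simp)
    (continuous_column i) (fun h _ g => column_mul h g i) (fun g _ => ⟨fun h0 => by
      have := norm_column g i
      rw [h0, norm_zero] at this
      exact zero_ne_one this, inner_zero_left _⟩)
  filter_upwards [h] with g hg
  have := hg trivial
  rw [inner_sub_right] at this
  exact sub_ne_zero.1 this

theorem ae_inner_normalVector_ne_zero {i j : Fin n} (hij : i ≠ j) {p q s : E n}
    (h : s - p ∉ Submodule.span ℝ {p - q}) :
    ∀ᵐ g ∂(haarO n), 0 < (inner ℝ (column g i) (p - q) : ℝ) →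
      (inner ℝ (normalVector i j (p - q) g) (s - p) : ℝ) ≠ 0 :=
  ae_inner_ne_zero (p - q) (s - p) h (φ := {g | 0 < (inner ℝ (column g i) (p - q) : ℝ)})
    (isOpen_lt continuous_const (continuous_inner_column i _)).measurableSet
    (fun h hh g => by rw [mem_ofPred_eq, mem_ofPred_eq, inner_column_mul hh])
    (continuous_normalVector i j _) (fun h hh g => normalVector_mul i j hh g)
    (fun g hg => ⟨normalVector_ne_zero hij hg, inner_normalVector i j _ g⟩)

theorem ae_inGeneralPosition {P : Set (E n)} {S : Finset (E n)} (hS : (S : Set (E n)) = vertices P)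
    {i j : Fin n} (hij : i ≠ j) {c : ℝ} (hc : c ≠ 0) :
    ∀ᵐ g ∂(haarO n), InGeneralPosition S (fun s => (inner ℝ (column g i) s : ℝ))
      (fun s => c * inner ℝ (column g j) s) := by
  have hv : ∀ p ∈ S, p ∈ vertices P := fun p hp => by rw [← hS]; exact hp
  have h1 : ∀ᵐ g ∂(haarO n), ∀ p ∈ S, ∀ q ∈ S, p ≠ q →
      (inner ℝ (column g i) p : ℝ) ≠ inner ℝ (column g i) q := by
    simp only [Finset.eventually_all, Filter.eventually_all]
    intro p _ q _ hpq
    exact ae_inner_column_ne i hpq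
  have h2 : ∀ᵐ g ∂(haarO n), ∀ p ∈ S, ∀ q ∈ S, ∀ s ∈ S, s ≠ p → s ≠ q →
      0 < (inner ℝ (column g i) (p - q) : ℝ) →
      (inner ℝ (normalVector i j (p - q) g) (s - p) : ℝ) ≠ 0 := by
    simp only [Finset.eventually_all, Filter.eventually_all]
    intro p hp q hq s hs hsp hsq
    exact ae_inner_normalVector_ne_zero hij
      (sub_notMem_span_of_vertices (hv p hp) (hv q hq) (hv s hs) hsp hsq)
  filter_upwards [h1, h2] with g hg1 hg2
  refine ⟨hg1, fun p hp q hq s hs _ hsp hsq hpos => ?_⟩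
  rw [turn_eq_inner_normalVector]
  rw [← inner_sub_right] at hpos
  exact mul_ne_zero hc (hg2 p hp q hq s hs hsp hsq hpos)

/-! ### Measurability and the expected number of vertices. -/

/-- The frames for which `p` projects to an exposed point of the projection of `S`. -/
def exposedFrames (S : Finset (E n)) (p : E n) : Set (E n × E n) :=
  {z | ∃ a b : ℝ, ∀ s ∈ S, s ≠ p →
    a * inner ℝ z.1 s + b * inner ℝ z.2 s < a * inner ℝ z.1 p + b * inner ℝ z.2 p}

theorem isOpen_exposedFrames (S : Finset (E n)) (p : E n) : IsOpen (exposedFrames S p) := by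
  have : exposedFrames S p = ⋃ a : ℝ, ⋃ b : ℝ, ⋂ s ∈ S, ⋂ (_ : s ≠ p),
      {z : E n × E n |
        a * inner ℝ z.1 s + b * inner ℝ z.2 s < a * inner ℝ z.1 p + b * inner ℝ z.2 p} := by
    ext z; simp [exposedFrames]
  rw [this]
  refine isOpen_iUnion fun a => isOpen_iUnion fun b => isOpen_biInter_finset fun s _ =>
    isOpen_iInter_of_finite fun _ => ?_
  exact isOpen_lt (by fun_prop) (by fun_prop)

theorem card_exposedVertices_eq (S : Finset (E n)) (z : E n × E n) :
    ((exposedVertices S (fun s => (inner ℝ z.1 s : ℝ)) (fun s => inner ℝ z.2 s)).card : ℝ) =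
      ∑ p ∈ S, (exposedFrames S p).indicator 1 z := by
  classical
  rw [exposedVertices, Finset.card_filter]
  push_cast
  refine Finset.sum_congr rfl fun p _ => ?_
  rw [indicator_apply]
  rfl

theorem card_upperEdges_eq (S : Finset (E n)) (i j : Fin n) (c : ℝ) (g : O n) :
    ((upperEdges S (fun s => (inner ℝ (column g i) s : ℝ))
      (fun s => c * inner ℝ (column g j) s)).card : ENNReal) =
      ∑ z ∈ S ×ˢ S, (edgeEvent S i j c z.1 z.2).indicator 1 g := by
  classical
  rw [upperEdges, Finset.card_filter]
  push_cast
  refine Finset.sum_congr rfl fun p _ => ?_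
  rw [indicator_apply]
  rfl

theorem lintegral_card_upperEdges_le (S : Finset (E n)) {i j : Fin n} (hij : i ≠ j) (c : ℝ) {k : ℕ}
    (hS : ∀ p ∈ S, ∀ l, ∃ z : ℤ, p l = z) (hk : ∀ p ∈ S, ∀ l, p l ∈ Icc (0 : ℝ) k) :
    ∫⁻ g, ((upperEdges S (fun s => (inner ℝ (column g i) s : ℝ))
      (fun s => c * inner ℝ (column g j) s)).card : ENNReal) ∂(haarO n) ≤ 2 * n * k := by
  refine le_trans (le_of_eq ?_) (sum_measure_edgeEvent_le S hij c hS hk)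
  simp only [card_upperEdges_eq]
  rw [lintegral_finsetSum _ fun z _ =>
    measurable_one.indicator (measurableSet_edgeEvent S i j c z.1 z.2)]
  exact Finset.sum_congr rfl fun z _ =>
    lintegral_indicator_one (measurableSet_edgeEvent S i j c z.1 z.2)

theorem measurable_card_upperEdges (S : Finset (E n)) (i j : Fin n) (c : ℝ) :
    Measurable fun g : O n => ((upperEdges S (fun s => (inner ℝ (column g i) s : ℝ))
      (fun s => c * inner ℝ (column g j) s)).card : ENNReal) := by
  simp only [card_upperEdges_eq]
  exact Finset.measurable_fun_sum _ fun z _ =>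
    measurable_one.indicator (measurableSet_edgeEvent S i j c z.1 z.2)

/-- Upper edges are counted with `c = 1` and lower edges with `c = -1`, each contributing at most
`2nk`. -/
theorem lintegral_card_exposedVertices_le {P : Set (E n)} {S : Finset (E n)}
    (hSP : (S : Set (E n)) = vertices P) {i j : Fin n} (hij : i ≠ j) {k : ℕ}
    (hS : ∀ p ∈ S, ∀ l, ∃ z : ℤ, p l = z) (hk : ∀ p ∈ S, ∀ l, p l ∈ Icc (0 : ℝ) k) :
    ∫⁻ g, ((exposedVertices S (fun s => (inner ℝ (column g i) s : ℝ))
      (fun s => inner ℝ (column g j) s)).card : ENNReal) ∂(haarO n) ≤ 4 * n * k + 4 := by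
  have hae : ∀ᵐ g ∂(haarO n), ((exposedVertices S (fun s => (inner ℝ (column g i) s : ℝ))
      (fun s => inner ℝ (column g j) s)).card : ENNReal) ≤
      ((upperEdges S (fun s => (inner ℝ (column g i) s : ℝ))
        (fun s => 1 * inner ℝ (column g j) s)).card : ENNReal) +
      ((upperEdges S (fun s => (inner ℝ (column g i) s : ℝ))
        (fun s => -1 * inner ℝ (column g j) s)).card : ENNReal) + 4 := by
    filter_upwards [ae_inGeneralPosition hSP hij one_ne_zero,
      ae_inGeneralPosition hSP hij (neg_ne_zero.2 one_ne_zero)] with g h1 h2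
    have hneg : (fun s => -1 * inner ℝ (column g j) s : E n → ℝ) =
        -(fun s => inner ℝ (column g j) s) := by ext s; simp
    simp only [one_mul] at h1 ⊢
    rw [hneg] at h2 ⊢
    exact_mod_cast card_exposedVertices_le h1 h2
  refine (lintegral_mono_ae hae).trans ?_
  rw [lintegral_add_right _ measurable_const,
    lintegral_add_left (measurable_card_upperEdges S i j 1), lintegral_const, measure_univ, mul_one]
  calc _ ≤ (2 * n * k + 2 * n * k + 4 : ENNReal) := by
        gcongr
        · exact lintegral_card_upperEdges_le S hij 1 hS hk
        · exact lintegral_card_upperEdges_le S hij (-1) hS hk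
    _ = 4 * n * k + 4 := by ring

theorem integrable_shadowSize_and_le (hn : 2 ≤ n) {k : ℕ} {P : Set (E n)} (hP : IsLatticePolytope P)
    (hk : ∀ x ∈ P, ∀ i, x i ∈ Icc (0 : ℝ) k) :
    Integrable (shadowSize P) (uniformFrame n hn) ∧ expectedShadowSize hn P ≤ 4 * n * k + 4 := by
  obtain ⟨hpoly, hint⟩ := hP
  set S : Finset (E n) := hpoly.finite_vertices.toFinset with hS
  have hSP : (S : Set (E n)) = vertices P := hpoly.finite_vertices.coe_toFinset
  have hPS : P = convexHull ℝ (S : Set (E n)) := by rw [hSP, hpoly.convexHull_vertices]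
  have hmem : ∀ p ∈ S, p ∈ vertices P := fun p hp => by rw [← hSP]; exact hp
  set i : Fin n := ⟨0, by omega⟩ with hi
  set j : Fin n := ⟨1, by omega⟩ with hj
  have hij : i ≠ j := by simp [hi, hj]
  set Φ : O n → E n × E n := fun g => (column g i, column g j) with hΦ
  have hΦm : Measurable Φ := ((continuous_column i).prodMk (continuous_column j)).measurable
  have hfr : uniformFrame n hn = (haarO n).map Φ := rfl
  -- A measurable bounded version of `shadowSize P`: a finite sum of indicators of open sets, equal
  -- to it whenever the first coordinates of the projected vertices are distinct.
  set T : E n × E n → ℝ := fun z => ∑ p ∈ S, (exposedFrames S p).indicator 1 z with hT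
  have hTm : Measurable T := Finset.measurable_fun_sum _ fun p _ =>
    measurable_one.indicator (isOpen_exposedFrames S p).measurableSet
  have hT0 : ∀ z, 0 ≤ T z := fun z =>
    Finset.sum_nonneg fun p _ => indicator_nonneg (fun _ _ => zero_le_one) _
  have hae : shadowSize P =ᵐ[uniformFrame n hn] T := by
    have hgood : ∀ᵐ z ∂(uniformFrame n hn), ∀ p ∈ S, ∀ q ∈ S, p ≠ q →
        (inner ℝ z.1 p : ℝ) ≠ inner ℝ z.1 q := by
      simp only [Finset.eventually_all, Filter.eventually_all]
      intro p _ q _ hpq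
      rw [hfr, ae_map_iff hΦm.aemeasurable]
      · exact ae_inner_column_ne i hpq
      · exact (isOpen_ne_fun (by fun_prop) (by fun_prop)).measurableSet
    filter_upwards [hgood] with z hz
    rw [shadowSize, hPS, ncard_vertices_shadow hz]
    exact card_exposedVertices_eq S z
  have hprob : IsProbabilityMeasure (uniformFrame n hn) := by
    rw [hfr]; exact Measure.isProbabilityMeasure_map hΦm.aemeasurable
  have hTi : Integrable T (uniformFrame n hn) := by
    refine integrable_finsetSum _ fun p _ => ?_
    exact (integrable_const (1 : ℝ)).indicator (isOpen_exposedFrames S p).measurableSet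
  refine ⟨hTi.congr hae.symm, ?_⟩
  rw [expectedShadowSize, integral_congr_ae hae,
    integral_eq_lintegral_of_nonneg_ae (Filter.Eventually.of_forall hT0) hTm.aestronglyMeasurable,
    hfr, lintegral_map hTm.ennreal_ofReal hΦm]
  have hle := lintegral_card_exposedVertices_le hSP hij (k := k)
    (fun p hp => hint p (hmem p hp)) (fun p hp => hk p (hmem p hp).1)
  have heq : ∀ g : O n, ENNReal.ofReal (T (Φ g)) =
      ((exposedVertices S (fun s => (inner ℝ (column g i) s : ℝ))
      (fun s => inner ℝ (column g j) s)).card : ENNReal) := by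
    intro g
    rw [← ENNReal.ofReal_natCast]
    congr 1
    exact (card_exposedVertices_eq S (Φ g)).symm
  simp only [heq]
  refine ENNReal.toReal_le_of_le_ofReal (by positivity) (hle.trans (le_of_eq ?_))
  have : (4 * n * k + 4 : ℝ) = ((4 * n * k + 4 : ℕ) : ℝ) := by push_cast; ring
  rw [this, ENNReal.ofReal_natCast]
  push_cast
  ring

end

end RandomShadow


theorem mainTheorem6 :
    ∃ C : ℝ, 0 < C ∧
      ∀ (n : ℕ) (hn : 2 ≤ n) (k : ℕ), 1 ≤ k →
        ∀ P : Set (RandomShadow.E n), RandomShadow.IsLatticePolytope P →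
          (∀ x ∈ P, ∀ i, x i ∈ Set.Icc (0 : ℝ) (k : ℝ)) →
            MeasureTheory.Integrable (RandomShadow.shadowSize P)
                (RandomShadow.uniformFrame n hn) ∧
              RandomShadow.expectedShadowSize hn P ≤ C * n * k := by
  -- The additive `4` is absorbed into `4nk` because `nk ≥ 1`.
  refine ⟨8, by norm_num, fun n hn k hk P hP hcube => ?_⟩
  obtain ⟨h1, h2⟩ := RandomShadow.integrable_shadowSize_and_le hn hP hcube
  refine ⟨h1, h2.trans ?_⟩
  have hn' : (2 : ℝ) ≤ n := by exact_mod_cast hn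
  have hk' : (1 : ℝ) ≤ k := by exact_mod_cast hk
  nlinarith
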